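/- **Setting.** Let $k$ be a field and let $\mathcal C$ be a $k$-linear rigid abelian symmetric tensor category with $\operatorname{End}(\underline 1)=k$, equipped with an exact, faithful, $k$-linear tensor functor $\omega$ from $\mathcal C$ to finite-dimensional $k$-vector spaces (for instance, a neutral differential Tannakian category over a differential field $k$ of characteristic zero; the differential structure is not used). For objects $X, V$ write $V\in\{\{X\}\}$ if $V$ is isomorphic to a subquotient of $X^n$ for some $n\ge 0$. For a finite-dimensional vector space $U$, the object $V\otimes U$ is a direct sum of $\dim U$ copies of $V$, with $\omega(V\otimes U)=\omega(V)\otimes U$. Let $P_X=F_X/R_X$, where $F_X=\bigoplus_{V\in\{\{X\}\}}V\otimes\omega(V)^*$ and $R_X$ is the smallest subobject containing all images $$\bigl(i_V(\mathrm{id}\otimes\omega(\phi)^*)-i_W(\phi\otimes\mathrm{id})\bigr)\bigl(V\otimes\omega(W)^*\bigr),\qquad \phi\in\operatorname{Hom}(V,W),\quad V,W\in\{\{X\}\},$$ with $i_V:V\otimes\omega(V)^*\to F_X$ the inclusions. That is, $P_X$ is an object of $\mathcal C$ with morphisms $\bar\imath_V:V\otimes\omega(V)^*\to P_X$ satisfying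 $\bar\imath_V(\mathrm{id}\otimes\omega(\phi)^*)=\bar\imath_W(\phi\otimes\mathrm{id})$ for all such $\phi$, and universal among such families of morphisms to objects of $\mathcal C$. Put $A_X=\omega(P_X)$, and for $v\in\omega(V)$, $u\in\omega(V)^*$ let $a_V(v\otimes u)=\omega(\bar\imath_V)(v\otimes u)\in A_X$. **Proposition 3.9.** For every object $X$ of $\mathcal C$: 1. $P_X$ exists in $\mathcal C$. The vector space $A_X$ is finite dimensional, and the map $\bigoplus_{V\in\{\{X\}\}}\omega(V)\otimes\omega(V)^*\to A_X$, $v\otimes u\mapsto a_V(v\otimes u)$, is surjective, with kernel spanned by the elements $(v\otimes\omega(\phi)^*(u))_V-(\omega(\phi)(v)\otimes u)_W$ for $\phi:V\to W$ in $\{\{X\}\}$, $v\in\omega(V)$, $u\in\omega(W)^*$. 2. There are unique $k$-linear maps $\Delta:A_X\to A_X\otimes A_X$ and $\varepsilon:A_X\to k$ with $$\Delta(a_V(v\otimes u))=\sum_i a_V(v_i\otimes u)\otimes a_V(v\otimes u_i),\qquad \varepsilon(a_V(v\otimes u))=u(v)$$ for all $V\in\{\{X\}\}$, $v\in\omega(V)$,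 $u\in\omega(V)^*$ and every basis $(v_i)$ of $\omega(V)$ with dual basis $(u_i)$. They make $A_X$ a coassociative, counital coalgebra. 3. Let $Y$ be an object with $X^*\in\{\{Y\}\}$ (for instance $Y=X^*$, or $Y=X$ if $X^*\in\{\{X\}\}$). Then $V^*\in\{\{Y\}\}$ for all $V\in\{\{X\}\}$, and there is a unique $k$-linear map $S:A_X\to A_Y$ with $S(a_V(v\otimes u))=a_{V^*}(u\otimes v)$ for all such $V$ and all $v\in\omega(V)$, $u\in\omega(V)^*=\omega(V^*)$. Let moreover $Z$ be an object with $Y\otimes X\in\{\{Z\}\}$ and $\underline 1\in\{\{Z\}\}$. Then $V\otimes W\in\{\{Z\}\}$ for all $V\in\{\{Y\}\}$, $W\in\{\{X\}\}$, there is a unique bilinear map $m:A_Y\times A_X\to A_Z$ with $m(a_V(v\otimes u),a_W(w\otimes t))=a_{V\otimes W}((v\otimes w)\otimes(u\otimes t))$, and $S$ satisfies the coinverse axiom $$m\circ(S\otimes\mathrm{id})\circ\Delta=\varepsilon(\cdot)\,a_{\underline 1}(e\otimes f),$$ where $e\in\omega(\underline 1)$ and $f\in\omega(\underline 1)^*$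 correspond to $1\in k$ and $\mathrm{id}_k$ under $\omega(\underline 1)\cong k$, so $f(e)=1$. -/

import Mathlib

open CategoryTheory CategoryTheory.Limits MonoidalCategory
open scoped TensorProduct

universe u v₁ u₁

noncomputable section

attribute [local instance] Abelian.hasFiniteBiproducts

namespace Tannaka

section Generated

variable {C : Type u₁} [Category.{v₁} C] [Abelian C]

/-- The full abelian subcategory `{{X}}` generated by `X`: the strictly full subcategory of the
objects isomorphic to a subquotient of some finite power `X ⊕ ⋯ ⊕ X`. -/
def generated (X : C) : ObjectProperty C := fun V =>
  ∃ (n : ℕ) (U : C) (i : U ⟶ ⨁ fun _ : Fin n => X) (p : U ⟶ V), Mono i ∧ Epi p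

end Generated

section VecTensor

variable {k : Type u} [Field k] {C : Type u₁} [Category.{v₁} C] [Abelian C] [Linear k C]

/-- The object `V ⊗ U` of `C`, for an object `V` of `C` and a finite dimensional `k`-vector space
`U`: the biproduct of `dim U` copies of `V`, indexed by the chosen basis `Module.finBasis k U`. -/
def vecTensor (k : Type u) [Field k] (V : C) (U : Type u) [AddCommGroup U] [Module k U] : C :=
  ⨁ fun _ : Fin (Module.finrank k U) => V

/-- The morphism `φ ⊗ f : V ⊗ U ⟶ V' ⊗ U'` attached to `φ : V ⟶ V'` and a linear map `f : U → U'`: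
the matrix of `f` in the chosen bases, with `φ` as a common factor. -/
def vecTensorMap {V V' : C} {U U' : Type u} [AddCommGroup U] [Module k U] [Module.Finite k U]
    [AddCommGroup U'] [Module k U'] [Module.Finite k U'] (φ : V ⟶ V') (f : U →ₗ[k] U') :
    vecTensor k V U ⟶ vecTensor k V' U' :=
  biproduct.matrix fun i j =>
    ((Module.finBasis k U').repr (f (Module.finBasis k U i)) j) • φ

/-- The canonical linear map `U → Hom(V, V ⊗ U)`, `x ↦ (v ↦ v ⊗ x)`. -/
def vecTensorIns (V : C) {U : Type u} [AddCommGroup U] [Module k U] [Module.Finite k U] :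
    U →ₗ[k] (V ⟶ vecTensor k V U) where
  toFun x := biproduct.lift fun i => ((Module.finBasis k U).repr x i) • 𝟙 V
  map_add' x y := by
    unfold vecTensor
    ext i
    simp [add_smul]
  map_smul' c x := by
    unfold vecTensor
    ext i
    simp [mul_smul]

/-- `(φ ⊗ f)(v ⊗ x) = φ(v) ⊗ f(x)`. -/
theorem vecTensorIns_comp_map {V V' : C} {U U' : Type u} [AddCommGroup U] [Module k U]
    [Module.Finite k U] [AddCommGroup U'] [Module k U'] [Module.Finite k U']
    (φ : V ⟶ V') (f : U →ₗ[k] U') (x : U) :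
    vecTensorIns V x ≫ vecTensorMap φ f = φ ≫ vecTensorIns V' (f x) := by
  have h (j) : (Module.finBasis k U').repr (f x) j = ∑ i, (Module.finBasis k U).repr x i *
      (Module.finBasis k U').repr (f (Module.finBasis k U i)) j := by
    calc _ = (Module.finBasis k U').repr (f (∑ i, (Module.finBasis k U).repr x i •
          Module.finBasis k U i)) j := by rw [Module.Basis.sum_repr]
      _ = _ := by
        simp only [map_sum, map_smul, Finsupp.coe_finsetSum, Finset.sum_apply,
          Finsupp.smul_apply, smul_eq_mul]
  change (biproduct.lift fun i => _) ≫ biproduct.matrix _ = φ ≫ biproduct.lift _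
  apply biproduct.hom_ext
  intro j
  simp [biproduct.lift_desc, h, Finset.sum_smul, Preadditive.comp_sum, smul_smul, mul_comm]

end VecTensor

variable {k : Type u} [Field k] {C : Type u₁} [Category.{v₁} C] [Abelian C] [Linear k C]

section Functor

variable (ω : C ⥤ FGModuleCat.{u} k)

/-- The linear map `ω(φ) : ω(V) → ω(W)`. -/
def fibMap {V W : C} (φ : V ⟶ W) : ω.obj V →ₗ[k] ω.obj W := (ω.map φ).hom.hom

/-- A model of the object `P_X = F_X / R_X` of `C`, where `F_X` is the direct sum of the objects
`V ⊗ ω(V)^*` over all `V` in `{{X}}`, and `R_X` is the smallest subobject containing the images of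
all `i_V ∘ (id ⊗ ω(φ)^*) - i_W ∘ (φ ⊗ id) : V ⊗ ω(W)^* → F_X`, `φ : V ⟶ W` in `{{X}}`. A morphism
out of `F_X` is a family of morphisms out of the summands, and the quotient by `R_X` is universal
among those that kill the displayed differences. -/
structure QuotientObject (X : C) where
  /-- the object `P_X` -/
  obj : C
  /-- the composite `V ⊗ ω(V)^* → F_X → P_X` -/
  incl : ∀ V : C, generated X V → (vecTensor k V (Module.Dual k (ω.obj V)) ⟶ obj)
  /-- the relations `R_X` are killed -/
  incl_rel : ∀ (V W : C) (hV : generated X V) (hW : generated X W) (φ : V ⟶ W),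
    vecTensorMap (𝟙 V) (fibMap ω φ).dualMap ≫ incl V hV =
      vecTensorMap φ (LinearMap.id : Module.Dual k (ω.obj W) →ₗ[k] _) ≫ incl W hW
  /-- universality -/
  existsUnique_desc : ∀ (T : C)
    (t : ∀ V : C, generated X V → (vecTensor k V (Module.Dual k (ω.obj V)) ⟶ T)),
    (∀ (V W : C) (hV : generated X V) (hW : generated X W) (φ : V ⟶ W),
      vecTensorMap (𝟙 V) (fibMap ω φ).dualMap ≫ t V hV =
        vecTensorMap φ (LinearMap.id : Module.Dual k (ω.obj W) →ₗ[k] _) ≫ t W hW) →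
    ∃! d : obj ⟶ T, ∀ (V : C) (hV : generated X V), incl V hV ≫ d = t V hV

namespace QuotientObject

variable {ω} {X : C}

/-- The vector space `A_X = ω(P_X)`. -/
abbrev A (P : QuotientObject ω X) : Type u := ω.obj P.obj

variable [ω.Additive] [ω.Linear k]

/-- The element `a_V(v ⊗ u)` of `A_X`, as a bilinear map in `v` and `u`: the image of `v ⊗ u`,
an element of `ω(V ⊗ ω(V)^*) = ω(V) ⊗ ω(V)^*`, under `ω(V ⊗ ω(V)^*) → ω(P_X)`. -/
def a (P : QuotientObject ω X) (V : C) (hV : generated X V) :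
    ω.obj V →ₗ[k] Module.Dual k (ω.obj V) →ₗ[k] P.A :=
  LinearMap.mk₂ k
    (fun v x => fibMap ω (P.incl V hV) (fibMap ω (vecTensorIns V x) v))
    (by intros; simp)
    (by intros; simp)
    (by
      intro v x y
      simp only [fibMap, map_add, Functor.map_add]
      exact map_add _ _ _)
    (by
      intro c v x
      simp only [fibMap, map_smul, Functor.map_smul]
      exact map_smul _ _ _)

open scoped Classical in
/-- The linear map `⨁_V ω(V) ⊗ ω(V)^* → A_X`, `v ⊗ u ↦ a_V(v ⊗ u)` (the map `ω(F_X) → ω(P_X)`). -/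
def fromSum (P : QuotientObject ω X) :
    (DirectSum {V : C // generated X V}
      fun V => (ω.obj V.1 : Type u) ⊗[k] Module.Dual k (ω.obj V.1)) →ₗ[k] P.A :=
  DirectSum.toModule k _ _ fun V => TensorProduct.lift (P.a V.1 V.2)

/-- `Δ : a_V(v ⊗ u) ↦ ∑ a_V(v_i ⊗ u) ⊗ a_V(v ⊗ u_i)`, for dual bases `(v_i)` and `(u_i)`. -/
def IsComul (P : QuotientObject ω X) (Δ : P.A →ₗ[k] P.A ⊗[k] P.A) : Prop :=
  ∀ (V : C) (hV : generated X V) (n : ℕ) (b : Module.Basis (Fin n) k (ω.obj V))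
    (v : ω.obj V) (x : Module.Dual k (ω.obj V)),
    Δ (P.a V hV v x) = ∑ i, P.a V hV (b i) x ⊗ₜ[k] P.a V hV v (b.coord i)

/-- `ε : a_V(v ⊗ u) ↦ u(v)`. -/
def IsCounit (P : QuotientObject ω X) (ε : P.A →ₗ[k] k) : Prop :=
  ∀ (V : C) (hV : generated X V) (v : ω.obj V) (x : Module.Dual k (ω.obj V)),
    ε (P.a V hV v x) = x v

end QuotientObject

/-- The subspace `ω(R_X)` of `⨁_V ω(V) ⊗ ω(V)^*`: the span of the elements
`i_V(v ⊗ ω(φ)^*(u)) - i_W(ω(φ)(v) ⊗ u)`. -/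
def relations (X : C) : Submodule k (DirectSum {V : C // generated X V}
    fun V => (ω.obj V.1 : Type u) ⊗[k] Module.Dual k (ω.obj V.1)) :=
  open scoped Classical in
  Submodule.span k {z | ∃ (V W : {V : C // generated X V}) (φ : V.1 ⟶ W.1) (v : ω.obj V.1)
    (x : Module.Dual k (ω.obj W.1)),
    z = DirectSum.lof k {V : C // generated X V}
          (fun V => (ω.obj V.1 : Type u) ⊗[k] Module.Dual k (ω.obj V.1)) V
          (v ⊗ₜ[k] (fibMap ω φ).dualMap x) -
        DirectSum.lof k {V : C // generated X V}
          (fun V => (ω.obj V.1 : Type u) ⊗[k] Module.Dual k (ω.obj V.1)) W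
          (fibMap ω φ v ⊗ₜ[k] x)}

end Functor

section Monoidal

variable [MonoidalCategory C] (ω : C ⥤ FGModuleCat.{u} k) [ω.Monoidal]

/-- The inverse structure map `ω(1) → k` of the tensor functor `ω`, as a linear form. -/
def unitForm : Module.Dual k (ω.obj (𝟙_ C)) := (Functor.OplaxMonoidal.η ω).hom.hom

/-- The vector `e` of `ω(1)` that corresponds to `1 ∈ k`. -/
def unitVec : ω.obj (𝟙_ C) := (Functor.LaxMonoidal.ε ω).hom.hom (1 : k)

/-- `v ⊗ w`, as a vector of `ω(V ⊗ W)`. -/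
def tensorVec {V W : C} (v : ω.obj V) (w : ω.obj W) : ω.obj (V ⊗ W) :=
  (Functor.LaxMonoidal.μ ω V W).hom.hom (v ⊗ₜ[k] w)

/-- `u ⊗ t`, as a linear form on `ω(V ⊗ W)`: it maps `v ⊗ w` to `u(v) t(w)`. -/
def tensorForm {V W : C} (x : Module.Dual k (ω.obj V)) (y : Module.Dual k (ω.obj W)) :
    Module.Dual k (ω.obj (V ⊗ W)) :=
  TensorProduct.dualDistrib k (ω.obj V) (ω.obj W) (x ⊗ₜ[k] y) ∘ₗ
    (Functor.OplaxMonoidal.δ ω V W).hom.hom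

/-- The pairing `ω(V^*) × ω(V) → ω(V^* ⊗ V) → ω(1) → k`, which identifies `ω(V^*)` with `ω(V)^*`
and `ω(V)` with `ω(V^*)^*`. -/
def dualPairing [RigidCategory C] (V : C) : ω.obj (Vᘁ) →ₗ[k] Module.Dual k (ω.obj V) :=
  TensorProduct.curry
    (unitForm ω ∘ₗ fibMap ω (ε_ V (Vᘁ)) ∘ₗ (Functor.LaxMonoidal.μ ω (Vᘁ) V).hom.hom)

variable {ω}

namespace QuotientObject

variable [ω.Additive] [ω.Linear k]

/-- `S : a_V(v ⊗ u) ↦ a_{V^*}(u ⊗ v)`. Here `u` in `ω(V)^*` is the linear form given by the vector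
`x` of `ω(V^*)`, and on the right-hand side `v` is read as a linear form on `ω(V^*)`. The target
`A_Y` belongs to an object `Y` such that `{{Y}}` contains the duals `V^*`, `V` in `{{X}}`; this
containment is part of the condition. -/
def IsCoinverse [RigidCategory C] {X Y : C} (P : QuotientObject ω X) (Q : QuotientObject ω Y)
    (S : P.A →ₗ[k] Q.A) : Prop :=
  ∀ (V : C) (hV : generated X V), ∃ hV' : generated Y (Vᘁ),
    ∀ (v : ω.obj V) (x : ω.obj (Vᘁ)),
      S (P.a V hV v (dualPairing ω V x)) = Q.a (Vᘁ) hV' x ((dualPairing ω V).flip v)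

/-- `m : a_V(v ⊗ u) · a_W(w ⊗ t) = a_{V ⊗ W}((v ⊗ w) ⊗ (u ⊗ t))`, as a bilinear map
`A_Y × A_X → A_Z`; that `{{Z}}` contains the objects `V ⊗ W` is part of the condition. -/
def IsMul {Y X Z : C} (Q : QuotientObject ω Y) (P : QuotientObject ω X)
    (R : QuotientObject ω Z) (m : Q.A →ₗ[k] P.A →ₗ[k] R.A) : Prop :=
  ∀ (V W : C) (hV : generated Y V) (hW : generated X W), ∃ hVW : generated Z (V ⊗ W),
    ∀ (v : ω.obj V) (x : Module.Dual k (ω.obj V)) (w : ω.obj W) (y : Module.Dual k (ω.obj W)),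
      m (Q.a V hV v x) (P.a W hW w y) =
        R.a (V ⊗ W) hVW (tensorVec ω v w) (tensorForm ω x y)

/-- The unit element `a_1(e ⊗ f)`, `f(e) = 1`, of `A_Z`, for `{{Z}}` containing the unit object. -/
def one {Z : C} (R : QuotientObject ω Z) (h : generated Z (𝟙_ C)) : R.A :=
  R.a (𝟙_ C) h (unitVec ω) (unitForm ω)

end QuotientObject

end Monoidal

end Tannaka

end

noncomputable section

attribute [local instance] Abelian.hasFiniteBiproducts

namespace Tannaka

/-! ### Closure properties of `{{X}}` -/

section Generated

variable {C : Type u₁} [Category.{v₁} C] [Abelian C] {X : C}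

/-! The object `P_X` represents the contravariant functor `V ↦ ω(V)^*` on `{{X}}`: there is a form
`e` on `ω(P_X)` such that every form on `ω(V)` is `e ∘ ω(f)` for exactly one `f : V ⟶ P_X`. Indeed,
a morphism `P_X ⟶ T` is a natural family of linear maps `ω(V)^* → Hom(V, T)`, and by Yoneda such a
family is determined by its value at `(P_X, e)`.

The content is the existence of a representing pair inside `{{X}}` (`exists_isUniversalForm`). Call
a form on `ω(V)` cogenerating if it vanishes on the image of no nonzero morphism to `V`. Every form
becomes cogenerating on a suitable quotient, and a cogenerating form forces `dim ω(V) ≤ dim ω(X ⊗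
ω(X)^*)` (`IsCogenerating.finrank_le`). A cogenerating pair `(P, x)` of maximal dimension is
universal: given `(V, y)`, pass to a cogenerating quotient of `(P ⊞ V, x + y)`. There `P` embeds, by
maximality isomorphically, so `V` maps to `P`.

Consequently each `p` in `A_X` is the single symbol `a_P(p ⊗ e)` with `P = P_X` (`a_counitForm`),
and `a_V(v ⊗ x)` is `ω(f)(v)` for the `f` representing `x`. So `Δ`, `S` and `m` need only be defined
on these symbols, and their formulas for general `V` follow by transport along `f`. The coinverse
axiom is transport along the evaluation `V^* ⊗ V ⟶ 1`. -/

theorem generated.of_epi {V W : C} (p : V ⟶ W) [Epi p] (hV : generated X V) : generated X W := by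
  obtain ⟨n, U, i, q, hi, hq⟩ := hV
  exact ⟨n, U, i, q ≫ p, hi, epi_comp q p⟩

/-- Take the preimage of `V` in the subobject of the power that covers `W`; epimorphisms in an
abelian category are stable under base change. -/
theorem generated.of_mono {V W : C} (j : V ⟶ W) [Mono j] (hW : generated X W) :
    generated X V := by
  obtain ⟨n, U, i, q, hi, hq⟩ := hW
  exact ⟨n, pullback q j, pullback.fst q j ≫ i, pullback.snd q j, mono_comp _ _, inferInstance⟩

theorem generated_power (X : C) (J : Type) [Finite J] : generated X (⨁ fun _ : J => X) := by
  obtain ⟨n, ⟨e⟩⟩ := Finite.exists_equiv_fin J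
  exact ⟨n, _, (biproduct.whiskerEquiv e fun _ => Iso.refl X).hom, 𝟙 _, inferInstance,
    inferInstance⟩

theorem generated_self (X : C) : generated X X :=
  (generated_power X Unit).of_mono (biproduct.ι (fun _ : Unit => X) ())

theorem generated.biproduct {J : Type} [Finite J] {f : J → C} (h : ∀ j, generated X (f j)) :
    generated X (⨁ f) := by
  choose n U i p hi hp using h
  have : Mono (biproduct.map i) := biproduct.map_mono i
  have : Epi (biproduct.map p) := biproduct.map_epi p
  exact ((generated_power X (Σ j, Fin (n j))).of_mono
    (biproduct.map i ≫ (biproductBiproductIso (fun j => Fin (n j)) fun _ _ => X).hom)).of_epi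
      (biproduct.map p)

theorem generated.biprod {V W : C} (hV : generated X V) (hW : generated X W) :
    generated X (V ⊞ W) := by
  let f : Bool → C := fun b => cond b V W
  have hf : generated X (⨁ f) := generated.biproduct fun b => by cases b <;> assumption
  let j : V ⊞ W ⟶ ⨁ f := biprod.desc (biproduct.ι f true) (biproduct.ι f false)
  let r : (⨁ f) ⟶ V ⊞ W := biproduct.desc fun b => match b with
    | true => (biprod.inl : V ⟶ V ⊞ W)
    | false => (biprod.inr : W ⟶ V ⊞ W)
  have hjr : j ≫ r = 𝟙 _ := by
    apply biprod.hom_ext' <;> simp [j, r]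
  have : Mono j := mono_of_mono_fac hjr
  exact hf.of_mono j

end Generated

/-! ### The adjunction between `V ⊗ U` and linear maps `U → Hom(V, T)` -/

section VecTensor

variable {k : Type u} [Field k] {C : Type u₁} [Category.{v₁} C] [Abelian C] [Linear k C]
  {V T : C} {U : Type u} [AddCommGroup U] [Module k U] [Module.Finite k U]

theorem vecTensorIns_finBasis (i : Fin (Module.finrank k U)) :
    vecTensorIns V (Module.finBasis k U i) = biproduct.ι (fun _ => V) i := by
  change biproduct.lift (fun j => _) = _
  apply biproduct.hom_ext
  intro j
  rw [biproduct.lift_π, Module.Basis.repr_self, biproduct.ι_π]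
  by_cases h : i = j
  · subst h; simp
  · simp [h]

theorem vecTensor_hom_ext {f g : vecTensor k V U ⟶ T}
    (h : ∀ x : U, vecTensorIns V x ≫ f = vecTensorIns V x ≫ g) : f = g := by
  apply biproduct.hom_ext'
  intro i
  rw [← vecTensorIns_finBasis]
  exact h _

/-- The morphism `V ⊗ U ⟶ T` attached to a linear map `U → Hom(V, T)`. -/
def vecTensorDesc (t : U →ₗ[k] (V ⟶ T)) : vecTensor k V U ⟶ T :=
  biproduct.desc fun i => t (Module.finBasis k U i)

theorem vecTensorIns_comp_desc (t : U →ₗ[k] (V ⟶ T)) (x : U) :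
    vecTensorIns V x ≫ vecTensorDesc t = t x := by
  change biproduct.lift _ ≫ biproduct.desc _ = _
  have h : t x = ∑ i, (Module.finBasis k U).repr x i • t (Module.finBasis k U i) := by
    conv_lhs => rw [← (Module.finBasis k U).sum_repr x]
    simp only [map_sum, map_smul]
  rw [h]
  simp [biproduct.lift_desc]

/-- Translates the relations defining `R_X` into naturality in `V` of the linear maps `ω(V)^* →
Hom(V, T)`. -/
theorem vecTensor_relation_iff {V W : C} {U' : Type u} [AddCommGroup U'] [Module k U']
    [Module.Finite k U'] (φ : V ⟶ W) (f : U' →ₗ[k] U) (s : vecTensor k V U ⟶ T)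
    (t : vecTensor k W U' ⟶ T) :
    vecTensorMap (𝟙 V) f ≫ s = vecTensorMap φ (LinearMap.id : U' →ₗ[k] U') ≫ t ↔
      ∀ x, vecTensorIns V (f x) ≫ s = φ ≫ vecTensorIns W x ≫ t := by
  have h (x : U') := vecTensorIns_comp_map (𝟙 V) f x
  have h' (x : U') := vecTensorIns_comp_map φ (LinearMap.id : U' →ₗ[k] U') x
  constructor
  · intro e x
    have := congrArg (vecTensorIns V x ≫ ·) e
    simpa only [← Category.assoc, h, h', Category.id_comp, LinearMap.id_apply] using this
  · intro e
    apply vecTensor_hom_ext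
    intro x
    rw [← Category.assoc, ← Category.assoc, h, h', Category.id_comp, Category.assoc, e,
      LinearMap.id_apply]

end VecTensor

/-! ### Exactness and faithfulness of the fibre functor -/

section Fiber

variable {k : Type u} [Field k] {C : Type u₁} [Category.{v₁} C] (ω : C ⥤ FGModuleCat.{u} k)

@[simp]
theorem fibMap_id (V : C) : fibMap ω (𝟙 V) = LinearMap.id := by simp [fibMap]

@[simp]
theorem fibMap_comp {U V W : C} (f : U ⟶ V) (g : V ⟶ W) :
    fibMap ω (f ≫ g) = fibMap ω g ∘ₗ fibMap ω f := by simp [fibMap]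

theorem fibMap_injective [ω.Faithful] {V W : C} {f g : V ⟶ W}
    (h : fibMap ω f = fibMap ω g) : f = g :=
  ω.map_injective (FGModuleCat.hom_ext h)

theorem fibMap_injective_of_mono [HasPullbacks C] [PreservesFiniteLimits ω] {V W : C} (f : V ⟶ W)
    [Mono f] : Function.Injective (fibMap ω f) := by
  have : Mono ((ω ⋙ forget₂ (FGModuleCat k) (ModuleCat.{u} k)).map f) := inferInstance
  exact (ModuleCat.mono_iff_injective _).1 this

theorem fibMap_surjective_of_epi [HasPushouts C] [PreservesFiniteColimits ω] {V W : C} (f : V ⟶ W)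
    [Epi f] : Function.Surjective (fibMap ω f) := by
  have : Epi ((ω ⋙ forget₂ (FGModuleCat k) (ModuleCat.{u} k)).map f) := inferInstance
  exact (ModuleCat.epi_iff_surjective _).1 this

variable {ω}

theorem mono_of_fibMap_injective [ω.Faithful] {V W : C} {f : V ⟶ W}
    (h : Function.Injective (fibMap ω f)) : Mono f := by
  refine ⟨fun a b e => fibMap_injective ω (LinearMap.ext fun x => h ?_)⟩
  have := congrArg (fibMap ω) e
  simpa using LinearMap.congr_fun this x

theorem epi_of_fibMap_surjective [ω.Faithful] {V W : C} {f : V ⟶ W}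
    (h : Function.Surjective (fibMap ω f)) : Epi f := by
  refine ⟨fun a b e => fibMap_injective ω (LinearMap.ext fun x => ?_)⟩
  obtain ⟨y, rfl⟩ := h x
  have := congrArg (fibMap ω) e
  simpa using LinearMap.congr_fun this y

section Abelian

variable [Abelian C] 

theorem isIso_of_mono_of_finrank_le [ω.Faithful] [PreservesFiniteLimits ω] {V W : C}
    (f : V ⟶ W) [Mono f]
    (h : Module.finrank k (ω.obj W) ≤ Module.finrank k (ω.obj V)) : IsIso f := by
  have hi := fibMap_injective_of_mono ω f
  have he : Module.finrank k (ω.obj V) = Module.finrank k (ω.obj W) :=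
    le_antisymm (LinearMap.finrank_le_finrank_of_injective hi) h
  have := epi_of_fibMap_surjective
    ((LinearMap.injective_iff_surjective_of_finrank_eq_finrank he).1 hi)
  exact isIso_of_mono_of_epi f

/-- By exactness the kernel of `ω(V) → ω(coker f)` is the image of `ω(f)`, so a form vanishing there
descends. -/
theorem exists_form_cokernel [ω.Additive] [PreservesFiniteLimits ω] [PreservesFiniteColimits ω]
    {K V : C} (f : K ⟶ V)
    (x : Module.Dual k (ω.obj V)) (h : x ∘ₗ fibMap ω f = 0) :
    ∃ y : Module.Dual k (ω.obj (cokernel f)), y ∘ₗ fibMap ω (cokernel.π f) = x := by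
  let F := ω ⋙ forget₂ (FGModuleCat k) (ModuleCat.{u} k)
  have hex : LinearMap.ker (fibMap ω (cokernel.π f)) ≤ LinearMap.range (fibMap ω f) := fun v hv =>
    (ShortComplex.moduleCat_exact_iff _).1 ((ShortComplex.exact_cokernel f).map F) v hv
  have hx : x ∈ LinearMap.range (fibMap ω (cokernel.π f)).dualMap := by
    rw [LinearMap.range_dualMap_eq_dualAnnihilator_ker, Submodule.mem_dualAnnihilator]
    intro v hv
    obtain ⟨w, rfl⟩ := hex hv
    exact LinearMap.congr_fun h w
  obtain ⟨y, rfl⟩ := hx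
  exact ⟨y, rfl⟩

end Abelian

end Fiber

end Tannaka

namespace Tannaka

section Additive

variable {k : Type u} [Field k] {C : Type u₁} [Category.{v₁} C] [Abelian C]
  (ω : C ⥤ FGModuleCat.{u} k)

theorem fibMap_smul [Linear k C] [ω.Linear k] {V W : C} (c : k) (f : V ⟶ W) :
    fibMap ω (c • f) = c • fibMap ω f := by
  simp only [fibMap, Functor.map_smul]
  rfl

variable [ω.Additive]

@[simp]
theorem fibMap_zero (V W : C) : fibMap ω (0 : V ⟶ W) = 0 := by simp [fibMap]

theorem fibMap_add {V W : C} (f g : V ⟶ W) : fibMap ω (f + g) = fibMap ω f + fibMap ω g := by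
  simp only [fibMap, Functor.map_add]
  rfl

theorem fibMap_sub {V W : C} (f g : V ⟶ W) : fibMap ω (f - g) = fibMap ω f - fibMap ω g := by
  simp only [fibMap, Functor.map_sub]
  rfl

theorem fibMap_sum {V W : C} {ι : Type*} (s : Finset ι) (f : ι → (V ⟶ W)) :
    fibMap ω (∑ i ∈ s, f i) = ∑ i ∈ s, fibMap ω (f i) := by
  classical
  induction s using Finset.induction_on with
  | empty => simp
  | insert a s ha ih => rw [Finset.sum_insert ha, Finset.sum_insert ha, fibMap_add, ih]

theorem fibMap_biproduct_ext {J : Type} [Finite J] {f : J → C} {M : Type*} [AddCommGroup M]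
    [Module k M] {g h : ω.obj (⨁ f) →ₗ[k] M}
    (e : ∀ j, g ∘ₗ fibMap ω (biproduct.ι f j) = h ∘ₗ fibMap ω (biproduct.ι f j)) : g = h := by
  classical
  have := Fintype.ofFinite J
  ext v
  have hv : v = ∑ j, fibMap ω (biproduct.ι f j) (fibMap ω (biproduct.π f j) v) := by
    have := LinearMap.congr_fun (congrArg (fibMap ω) (biproduct.total (f := f))) v
    rw [fibMap_sum, fibMap_id, LinearMap.sum_apply] at this
    simpa only [fibMap_comp, LinearMap.comp_apply, LinearMap.id_apply] using this.symm
  rw [hv, map_sum, map_sum]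
  exact Finset.sum_congr rfl fun j _ => LinearMap.congr_fun (e j) _

end Additive

/-! ### Existence of a universal form -/

section Universal

variable {k : Type u} [Field k] {C : Type u₁} [Category.{v₁} C] [Abelian C]
  (ω : C ⥤ FGModuleCat.{u} k)

/-- The form `v ⊗ x ↦ x(v)` on `ω(V ⊗ ω(V)^*)`. -/
theorem exists_evaluation_form [Linear k C] [ω.Linear k] (V : C) :
    ∃ w : Module.Dual k (ω.obj (vecTensor k V (Module.Dual k (ω.obj V)))),
      ∀ x, w ∘ₗ fibMap ω (vecTensorIns V x) = x := by
  let b := Module.finBasis k (Module.Dual k (ω.obj V))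
  let pr (i) : vecTensor k V (Module.Dual k (ω.obj V)) ⟶ V := biproduct.π _ i
  refine ⟨∑ i, b i ∘ₗ fibMap ω (pr i), fun x => ?_⟩
  have hpr (i) : vecTensorIns V x ≫ pr i = b.repr x i • 𝟙 V := biproduct.lift_π _ _
  conv_rhs => rw [← b.sum_repr x]
  ext v
  rw [LinearMap.comp_apply, LinearMap.sum_apply, LinearMap.sum_apply]
  refine Finset.sum_congr rfl fun i _ => ?_
  have := congrArg (fibMap ω) (hpr i)
  rw [fibMap_comp, fibMap_smul, fibMap_id] at this
  simpa using congrArg (b i) (LinearMap.congr_fun this v)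

/-- A linear form on `ω(V)` that vanishes on the image of no nonzero morphism to `V`. -/
def IsCogenerating (V : C) (x : Module.Dual k (ω.obj V)) : Prop :=
  ∀ (K : C) (f : K ⟶ V), x ∘ₗ fibMap ω f = 0 → f = 0

variable {ω} [ω.Additive] [PreservesFiniteLimits ω] [PreservesFiniteColimits ω]

/-- If `V` is a quotient of `U ⊆ X^n`, then `V` is already a quotient of the image of `U` in `X ⊗
ω(X)^*`, under a map chosen to remember the pullback of `x` to `ω(U)`. -/
theorem IsCogenerating.finrank_le [Linear k C] [ω.Linear k] {X V : C}
    (hV : generated X V) {x : Module.Dual k (ω.obj V)} (hx : IsCogenerating ω V x) :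
    Module.finrank k (ω.obj V) ≤
      Module.finrank k (ω.obj (vecTensor k X (Module.Dual k (ω.obj X)))) := by
  obtain ⟨n, U, i, p, hi, hp⟩ := hV
  -- The form on `ω(U)` extends linearly to `ω(X^n)`; its `n` components on `ω(X)` then define `q`.
  obtain ⟨y, hy⟩ := LinearMap.dualMap_surjective_of_injective (fibMap_injective_of_mono ω i)
    (x ∘ₗ fibMap ω p)
  obtain ⟨w, hw⟩ := exists_evaluation_form ω X
  let q : (⨁ fun _ : Fin n => X) ⟶ vecTensor k X (Module.Dual k (ω.obj X)) :=
    biproduct.desc fun j => vecTensorIns X (y ∘ₗ fibMap ω (biproduct.ι (fun _ => X) j))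
  have hq : w ∘ₗ fibMap ω q = y := fibMap_biproduct_ext ω fun j => by
    rw [LinearMap.comp_assoc, ← fibMap_comp, biproduct.ι_desc, hw]
  -- The pulled-back form factors through `ω(i ≫ q)`, so it kills the kernel; since `x` is
  -- cogenerating, `p` itself does.
  have h0 : kernel.ι (i ≫ q) ≫ p = 0 := hx _ _ <| by
    rw [fibMap_comp, ← LinearMap.comp_assoc, ← hy, ← hq]
    change w ∘ₗ (fibMap ω q ∘ₗ fibMap ω i) ∘ₗ _ = 0
    rw [← fibMap_comp, ← fibMap_comp, kernel.condition, fibMap_zero, LinearMap.comp_zero]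
  let d : Abelian.coimage (i ≫ q) ⟶ V := cokernel.desc _ p h0
  have hd : cokernel.π _ ≫ d = p := cokernel.π_desc _ _ _
  have : Epi d := epi_of_epi_fac hd
  exact (LinearMap.finrank_le_finrank_of_surjective (fibMap_surjective_of_epi ω d)).trans
    (LinearMap.finrank_le_finrank_of_injective
      (fibMap_injective_of_mono ω (Abelian.factorThruCoimage (i ≫ q))))

/-- As long as some nonzero `f` has its image in the kernel of the form, pass to `cokernel f`;
faithfulness makes the dimension drop, so this stops. -/
theorem exists_isCogenerating_quotient [ω.Faithful] (V : C) (x : Module.Dual k (ω.obj V)) :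
    ∃ (W : C) (q : V ⟶ W) (y : Module.Dual k (ω.obj W)), Epi q ∧ y ∘ₗ fibMap ω q = x ∧
      IsCogenerating ω W y := by
  induction h : Module.finrank k (ω.obj V) using Nat.strong_induction_on generalizing V with
  | _ n ih =>
  subst h
  by_cases hx : IsCogenerating ω V x
  · exact ⟨V, 𝟙 V, x, inferInstance, by simp, hx⟩
  · obtain ⟨K, f, hf, hf0⟩ : ∃ (K : C) (f : K ⟶ V), x ∘ₗ fibMap ω f = 0 ∧ f ≠ 0 := by
      simpa [IsCogenerating] using hx
    obtain ⟨y, rfl⟩ := exists_form_cokernel f x hf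
    have hlt : Module.finrank k (ω.obj (cokernel f)) < Module.finrank k (ω.obj V) := by
      have hs := fibMap_surjective_of_epi ω (cokernel.π f)
      refine lt_of_le_of_ne (LinearMap.finrank_le_finrank_of_surjective hs) fun e => hf0 ?_
      have hi := (LinearMap.injective_iff_surjective_of_finrank_eq_finrank e.symm).2 hs
      have := mono_of_fibMap_injective hi
      exact zero_of_comp_mono (cokernel.π f) (cokernel.condition f)
    obtain ⟨W, q, z, hq, rfl, hz⟩ := ih _ hlt (cokernel f) y rfl
    exact ⟨W, cokernel.π f ≫ q, z, epi_comp _ _, by rw [fibMap_comp]; rfl, hz⟩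

variable (ω) in
/-- The form `x` on `ω(P)` represents the functor `V ↦ ω(V)^*` on `{{X}}`. -/
structure IsUniversalForm (X P : C) (x : Module.Dual k (ω.obj P)) : Prop where
  mem_generated : generated X P
  exists_hom : ∀ V, generated X V → ∀ y : Module.Dual k (ω.obj V),
    ∃ f : V ⟶ P, x ∘ₗ fibMap ω f = y
  isCogenerating : IsCogenerating ω P x

variable (ω) in
-- A cogenerating pair of maximal dimension absorbs every other pair.
theorem exists_isUniversalForm [Linear k C] [ω.Linear k] [ω.Faithful] (X : C) :
    ∃ (P : C) (x : Module.Dual k (ω.obj P)), IsUniversalForm ω X P x := by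
  let s : Set ℕ := {n | ∃ (P : C) (x : Module.Dual k (ω.obj P)), generated X P ∧
    IsCogenerating ω P x ∧ Module.finrank k (ω.obj P) = n}
  have hs : BddAbove s := ⟨_, by
    rintro _ ⟨P, x, hP, hx, rfl⟩
    exact hx.finrank_le hP⟩
  have hne : s.Nonempty := by
    obtain ⟨W, q, y, hq, -, hy⟩ := exists_isCogenerating_quotient (ω := ω) X 0
    exact ⟨_, W, y, (generated_self X).of_epi q, hy, rfl⟩
  obtain ⟨P, x, hP, hx, hn⟩ := Nat.sSup_mem hne hs
  refine ⟨P, x, hP, fun V hV y => ?_, hx⟩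
  obtain ⟨Q, q, z, hq, hz, hzc⟩ := exists_isCogenerating_quotient (ω := ω) (P ⊞ V)
    (x ∘ₗ fibMap ω biprod.fst + y ∘ₗ fibMap ω biprod.snd)
  have hl : z ∘ₗ fibMap ω (biprod.inl ≫ q) = x := by
    rw [fibMap_comp, ← LinearMap.comp_assoc, hz, LinearMap.add_comp, LinearMap.comp_assoc,
      LinearMap.comp_assoc, ← fibMap_comp, ← fibMap_comp]
    simp
  have hr : z ∘ₗ fibMap ω (biprod.inr ≫ q) = y := by
    rw [fibMap_comp, ← LinearMap.comp_assoc, hz, LinearMap.add_comp, LinearMap.comp_assoc,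
      LinearMap.comp_assoc, ← fibMap_comp, ← fibMap_comp]
    simp
  -- A morphism killed by `P ⟶ Q` is killed by `x`, the restriction of `z`, hence is zero.
  have : Mono (biprod.inl ≫ q : P ⟶ Q) := Preadditive.mono_of_cancel_zero _ fun g hg =>
    hx _ g <| by
      rw [← hl, LinearMap.comp_assoc, ← fibMap_comp, hg, fibMap_zero, LinearMap.comp_zero]
  have : IsIso (biprod.inl ≫ q : P ⟶ Q) := isIso_of_mono_of_finrank_le (ω := ω) _ <| by
    rw [hn]
    exact le_csSup hs ⟨Q, z, (hP.biprod hV).of_epi q, hzc, rfl⟩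
  refine ⟨(biprod.inr ≫ q) ≫ inv (biprod.inl ≫ q), ?_⟩
  rw [← hr, ← hl, LinearMap.comp_assoc, ← fibMap_comp, Category.assoc, IsIso.inv_hom_id,
    Category.comp_id]

end Universal

end Tannaka

/-! ### Comparison of `P_X` with the representing object; presentation of `A_X` -/

namespace Tannaka

variable {k : Type u} [Field k] {C : Type u₁} [Category.{v₁} C] [Abelian C] [Linear k C]
  {ω : C ⥤ FGModuleCat.{u} k} {X : C}

namespace QuotientObject

/-- The morphism `V ⟶ P_X`, `v ↦ a_V(v ⊗ x)`. -/
def hom (P : QuotientObject ω X) (V : C) (hV : generated X V) (x : Module.Dual k (ω.obj V)) :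
    V ⟶ P.obj :=
  vecTensorIns V x ≫ P.incl V hV

theorem hom_add (P : QuotientObject ω X) (V : C) (hV : generated X V)
    (x y : Module.Dual k (ω.obj V)) : P.hom V hV (x + y) = P.hom V hV x + P.hom V hV y := by
  simp [hom]

theorem hom_smul (P : QuotientObject ω X) (V : C) (hV : generated X V) (c : k)
    (x : Module.Dual k (ω.obj V)) : P.hom V hV (c • x) = c • P.hom V hV x := by
  simp [hom]

theorem hom_comp_fibMap (P : QuotientObject ω X) {V W : C} (hV : generated X V)
    (hW : generated X W) (φ : V ⟶ W) (x : Module.Dual k (ω.obj W)) :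
    P.hom V hV (x ∘ₗ fibMap ω φ) = φ ≫ P.hom W hW x :=
  (vecTensor_relation_iff φ (fibMap ω φ).dualMap _ _).1 (P.incl_rel V W hV hW φ) x

/-- The universal property of `P_X` in the form used from here on, with natural families in place of
morphisms out of `V ⊗ ω(V)^*`. -/
theorem existsUnique_comp_eq (P : QuotientObject ω X) (T : C)
    (t : ∀ V, generated X V → Module.Dual k (ω.obj V) →ₗ[k] (V ⟶ T))
    (ht : ∀ V W (hV : generated X V) (hW : generated X W) (φ : V ⟶ W) x,
      t V hV (x ∘ₗ fibMap ω φ) = φ ≫ t W hW x) :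
    ∃! d : P.obj ⟶ T, ∀ V (hV : generated X V) x, P.hom V hV x ≫ d = t V hV x := by
  have key (d : P.obj ⟶ T) : (∀ V (hV : generated X V), P.incl V hV ≫ d = vecTensorDesc (t V hV)) ↔
      ∀ V (hV : generated X V) x, P.hom V hV x ≫ d = t V hV x := by
    refine forall_congr' fun V => forall_congr' fun hV => ⟨fun h x => ?_, fun h => ?_⟩
    · rw [hom, Category.assoc, h, vecTensorIns_comp_desc]
    · refine vecTensor_hom_ext fun x => ?_
      rw [vecTensorIns_comp_desc, ← h, hom, Category.assoc]
  simp only [← key]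
  refine P.existsUnique_desc T _ fun V W hV hW φ => (vecTensor_relation_iff _ _ _ _).2 fun x => ?_
  rw [vecTensorIns_comp_desc, vecTensorIns_comp_desc]
  exact ht V W hV hW φ x

/-- The morphisms `V ⟶ P_X`, `v ↦ a_V(v ⊗ x)`, depend linearly on `x`. -/
def homₗ (P : QuotientObject ω X) (V : C) (hV : generated X V) :
    Module.Dual k (ω.obj V) →ₗ[k] (V ⟶ P.obj) where
  toFun := P.hom V hV
  map_add' := P.hom_add V hV
  map_smul' := P.hom_smul V hV

theorem endomorphism_eq_id (P : QuotientObject ω X) (d : P.obj ⟶ P.obj)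
    (hd : ∀ V (hV : generated X V) x, P.hom V hV x ≫ d = P.hom V hV x) : d = 𝟙 _ :=
  (P.existsUnique_comp_eq P.obj (P.homₗ)
    fun _ _ hV hW φ x => P.hom_comp_fibMap hV hW φ x).unique hd fun _ _ _ => Category.comp_id _

end QuotientObject

variable [ω.Additive]

theorem IsUniversalForm.hom_ext {P : C} {e : Module.Dual k (ω.obj P)}
    (h : IsUniversalForm ω X P e) {V : C} {f g : V ⟶ P}
    (hfg : e ∘ₗ fibMap ω f = e ∘ₗ fibMap ω g) : f = g :=
  sub_eq_zero.1 <| h.isCogenerating _ _ <| by rw [fibMap_sub, LinearMap.comp_sub, hfg, sub_self]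

variable [ω.Linear k]

namespace IsUniversalForm

variable {P : C} {e : Module.Dual k (ω.obj P)}

/-- The morphism `V ⟶ P` that represents a linear form on `ω(V)`. -/
def hom (h : IsUniversalForm ω X P e) (V : C) (hV : generated X V) :
    Module.Dual k (ω.obj V) →ₗ[k] (V ⟶ P) where
  toFun x := (h.exists_hom V hV x).choose
  map_add' x y := h.hom_ext <| by
    rw [fibMap_add, LinearMap.comp_add, (h.exists_hom V hV _).choose_spec,
      (h.exists_hom V hV _).choose_spec, (h.exists_hom V hV _).choose_spec]
  map_smul' c x := h.hom_ext <| by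
    rw [fibMap_smul, LinearMap.comp_smul, (h.exists_hom V hV _).choose_spec,
      (h.exists_hom V hV _).choose_spec, RingHom.id_apply]

theorem comp_hom (h : IsUniversalForm ω X P e) {V : C} (hV : generated X V)
    (x : Module.Dual k (ω.obj V)) : e ∘ₗ fibMap ω (h.hom V hV x) = x :=
  (h.exists_hom V hV x).choose_spec

theorem hom_comp_fibMap (h : IsUniversalForm ω X P e) {V W : C} (hV : generated X V)
    (hW : generated X W) (φ : V ⟶ W) (x : Module.Dual k (ω.obj W)) :
    h.hom V hV (x ∘ₗ fibMap ω φ) = φ ≫ h.hom W hW x :=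
  h.hom_ext <| by
    rw [h.comp_hom, fibMap_comp, ← LinearMap.comp_assoc, h.comp_hom]

theorem hom_self (h : IsUniversalForm ω X P e) : h.hom P h.mem_generated e = 𝟙 P :=
  h.hom_ext <| by rw [h.comp_hom, fibMap_id, LinearMap.comp_id]

/-- An object that represents `V ↦ ω(V)^*` is a model of `P_X`. -/
def quotientObject (h : IsUniversalForm ω X P e) : QuotientObject ω X where
  obj := P
  incl V hV := vecTensorDesc (h.hom V hV)
  incl_rel V W hV hW φ := (vecTensor_relation_iff _ _ _ _).2 fun x => by
    rw [vecTensorIns_comp_desc, vecTensorIns_comp_desc]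
    exact h.hom_comp_fibMap hV hW φ x
  existsUnique_desc T t ht := by
    -- Yoneda: `x` is the pullback of `e` along `h.hom V hV x`, so naturality expresses `t V`
    -- through its value at `(P, e)`.
    have ht' (V : C) (hV : generated X V) (x : Module.Dual k (ω.obj V)) :
        vecTensorIns V x ≫ t V hV = h.hom V hV x ≫ vecTensorIns P e ≫ t P h.mem_generated := by
      rw [← (vecTensor_relation_iff _ _ _ _).1 (ht V P hV h.mem_generated (h.hom V hV x)) e]
      exact congrArg (fun y => vecTensorIns V y ≫ t V hV) (h.comp_hom hV x).symm
    refine ⟨vecTensorIns P e ≫ t P h.mem_generated, fun V hV => vecTensor_hom_ext fun x => ?_,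
      fun d hd => ?_⟩
    · rw [← Category.assoc, vecTensorIns_comp_desc]
      exact (ht' V hV x).symm
    · rw [← hd, ← Category.assoc, vecTensorIns_comp_desc, hom_self, Category.id_comp]

theorem quotientObject_hom (h : IsUniversalForm ω X P e) (V : C) (hV : generated X V)
    (x : Module.Dual k (ω.obj V)) : h.quotientObject.hom V hV x = h.hom V hV x :=
  vecTensorIns_comp_desc _ _

end IsUniversalForm

namespace QuotientObject

theorem a_apply (P : QuotientObject ω X) {V : C} (hV : generated X V) (v : ω.obj V)
    (x : Module.Dual k (ω.obj V)) : P.a V hV v x = fibMap ω (P.hom V hV x) v := by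
  rw [hom, fibMap_comp]
  rfl

theorem a_comp_fibMap (P : QuotientObject ω X) {V W : C} (hV : generated X V)
    (hW : generated X W) (φ : V ⟶ W) (v : ω.obj V) (x : Module.Dual k (ω.obj W)) :
    P.a V hV v (x ∘ₗ fibMap ω φ) = P.a W hW (fibMap ω φ v) x := by
  rw [a_apply, a_apply, P.hom_comp_fibMap hV hW, fibMap_comp, LinearMap.comp_apply]

theorem fromSum_lof (P : QuotientObject ω X) (V : {V : C // generated X V}) (v : ω.obj V.1)
    (x : Module.Dual k (ω.obj V.1)) :
    P.fromSum (open scoped Classical in DirectSum.lof k {V : C // generated X V}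
      (fun V => (ω.obj V.1 : Type u) ⊗[k] Module.Dual k (ω.obj V.1)) V (v ⊗ₜ[k] x)) =
      P.a V.1 V.2 v x := by
  classical
  rw [fromSum]
  erw [DirectSum.toModule_lof]
  exact TensorProduct.lift.tmul _ _

variable [ω.Faithful] [PreservesFiniteLimits ω] [PreservesFiniteColimits ω]

variable (ω X) in
theorem nonempty : Nonempty (QuotientObject ω X) := by
  obtain ⟨P, e, h⟩ := exists_isUniversalForm ω X
  exact ⟨h.quotientObject⟩

/-- The form `a_V(v ⊗ x) ↦ x(v)` on `A_X` represents `V ↦ ω(V)^*`. -/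
theorem exists_form (P : QuotientObject ω X) : ∃ e : Module.Dual k P.A,
    IsUniversalForm ω X P.obj e ∧ ∀ V (hV : generated X V) x,
      e ∘ₗ fibMap ω (P.hom V hV x) = x := by
  -- `P` is an arbitrary model; universality on both sides gives an isomorphism with the
  -- representing object, along which `e` is transported.
  obtain ⟨T, e, h⟩ := exists_isUniversalForm ω X
  obtain ⟨d, hd, -⟩ := P.existsUnique_comp_eq T h.hom fun _ _ hV hW φ x =>
    h.hom_comp_fibMap hV hW φ x
  obtain ⟨d', hd', -⟩ := h.quotientObject.existsUnique_comp_eq P.obj P.homₗ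
    fun _ _ hV hW φ x => P.hom_comp_fibMap hV hW φ x
  simp only [IsUniversalForm.quotientObject_hom] at hd'
  change T ⟶ P.obj at d'
  have h₁ : d ≫ d' = 𝟙 _ := P.endomorphism_eq_id _ fun V hV x => by
    rw [← Category.assoc, hd]
    exact hd' V hV x
  have h₂ : d' ≫ d = 𝟙 _ := h.quotientObject.endomorphism_eq_id _ fun V hV x => by
    rw [IsUniversalForm.quotientObject_hom]
    exact (Category.assoc _ _ _).symm.trans ((congrArg (· ≫ d) (hd' V hV x)).trans (hd V hV x))
  have : IsIso d := ⟨d', h₁, h₂⟩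
  have he (V : C) (hV : generated X V) (x : Module.Dual k (ω.obj V)) :
      (e ∘ₗ fibMap ω d) ∘ₗ fibMap ω (P.hom V hV x) = x := by
    rw [LinearMap.comp_assoc, ← fibMap_comp, hd, h.comp_hom]
  refine ⟨e ∘ₗ fibMap ω d, ⟨h.mem_generated.of_mono d, fun V hV x => ⟨_, he V hV x⟩,
    fun K f hf => ?_⟩, he⟩
  rw [LinearMap.comp_assoc, ← fibMap_comp] at hf
  exact zero_of_comp_mono d (h.isCogenerating _ _ hf)

/-- The counit `a_V(v ⊗ x) ↦ x(v)` of `A_X`. -/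
def counitForm (P : QuotientObject ω X) : Module.Dual k P.A := P.exists_form.choose

theorem isUniversalForm (P : QuotientObject ω X) : IsUniversalForm ω X P.obj P.counitForm :=
  P.exists_form.choose_spec.1

theorem counitForm_comp_hom (P : QuotientObject ω X) {V : C} (hV : generated X V)
    (x : Module.Dual k (ω.obj V)) : P.counitForm ∘ₗ fibMap ω (P.hom V hV x) = x :=
  P.exists_form.choose_spec.2 V hV x

theorem generated_obj (P : QuotientObject ω X) : generated X P.obj := P.isUniversalForm.mem_generated

theorem isCounit_counitForm (P : QuotientObject ω X) : P.IsCounit P.counitForm := by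
  intro V hV v x
  rw [a_apply]
  exact LinearMap.congr_fun (P.counitForm_comp_hom hV x) v

/-- The morphism representing `ε` on `P_X` itself is the identity. This makes `fromSum` surjective
and lets linear maps on `A_X` be compared on single symbols. -/
theorem a_counitForm (P : QuotientObject ω X) (p : P.A) :
    P.a P.obj P.generated_obj p P.counitForm = p := by
  have : P.hom P.obj P.generated_obj P.counitForm = 𝟙 _ :=
    P.isUniversalForm.hom_ext <| by
      rw [P.counitForm_comp_hom, fibMap_id, LinearMap.comp_id]
  rw [a_apply, this, fibMap_id, LinearMap.id_apply]

/-- Every element `a_V(v ⊗ x)` is the value at `v` of a morphism `V ⟶ P_X`. -/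
theorem exists_hom_eq (P : QuotientObject ω X) {V : C} (hV : generated X V)
    (x : Module.Dual k (ω.obj V)) : ∃ f : V ⟶ P.obj, P.counitForm ∘ₗ fibMap ω f = x ∧
      ∀ v, P.a V hV v x = fibMap ω f v :=
  ⟨P.hom V hV x, P.counitForm_comp_hom hV x, fun v => P.a_apply hV v x⟩

theorem hom_ext_a (P : QuotientObject ω X) {M : Type*} [AddCommMonoid M] [Module k M]
    {f g : P.A →ₗ[k] M} (h : ∀ V (hV : generated X V) v x, f (P.a V hV v x) = g (P.a V hV v x)) :
    f = g := by
  ext p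
  have := h P.obj P.generated_obj p P.counitForm
  rwa [a_counitForm] at this

theorem fromSum_surjective (P : QuotientObject ω X) : Function.Surjective P.fromSum := fun p =>
  ⟨_, (P.fromSum_lof ⟨P.obj, P.generated_obj⟩ p P.counitForm).trans (P.a_counitForm p)⟩

theorem ker_fromSum (P : QuotientObject ω X) : LinearMap.ker P.fromSum = relations ω X := by
  classical
  apply le_antisymm
  · let s : P.A →ₗ[k] DirectSum {V : C // generated X V}
        fun V => (ω.obj V.1 : Type u) ⊗[k] Module.Dual k (ω.obj V.1) :=
      DirectSum.lof k {V : C // generated X V}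
        (fun V => (ω.obj V.1 : Type u) ⊗[k] Module.Dual k (ω.obj V.1)) ⟨P.obj, P.generated_obj⟩ ∘ₗ
        (TensorProduct.mk k P.A (Module.Dual k P.A)).flip P.counitForm
    -- The map `s` sends `p` to `p ⊗ ε` in the summand of `P_X`. Modulo relations every `v ⊗ x`
    -- moves into that summand along the morphism representing `x`, so its class depends only on its
    -- image in `A_X`.
    have key : (relations ω X).mkQ = (relations ω X).mkQ ∘ₗ s ∘ₗ P.fromSum := by
      refine DirectSum.linearMap_ext k fun V => TensorProduct.ext' fun v x => ?_
      obtain ⟨f, rfl, hf⟩ := P.exists_hom_eq V.2 x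
      have hs := P.fromSum_lof V v (P.counitForm ∘ₗ fibMap ω f)
      simp only [LinearMap.comp_apply]
      rw [← sub_eq_zero, ← map_sub, Submodule.mkQ_apply, Submodule.Quotient.mk_eq_zero]
      apply Submodule.subset_span
      refine ⟨V, ⟨P.obj, P.generated_obj⟩, f, v, P.counitForm, ?_⟩
      exact congrArg₂ (· - ·) rfl (congrArg s (hs.trans (hf v)))
    intro z hz
    rw [LinearMap.mem_ker] at hz
    have := LinearMap.congr_fun key z
    rw [LinearMap.comp_apply, LinearMap.comp_apply, hz, map_zero, map_zero] at this
    exact (Submodule.Quotient.mk_eq_zero _).1 this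
  · refine Submodule.span_le.2 ?_
    rintro _ ⟨V, W, φ, v, x, rfl⟩
    rw [SetLike.mem_coe, LinearMap.mem_ker, map_sub]
    refine sub_eq_zero.2 ?_
    refine (P.fromSum_lof _ _ _).trans (Eq.trans ?_ (P.fromSum_lof _ _ _).symm)
    exact P.a_comp_fibMap V.2 W.2 φ v x

end QuotientObject

end Tannaka

/-! ### The coalgebra structure -/

namespace Tannaka

namespace QuotientObject

variable {k : Type u} [Field k] {C : Type u₁} [Category.{v₁} C] [Abelian C] [Linear k C]
  {ω : C ⥤ FGModuleCat.{u} k} {X : C} [ω.Additive] [ω.Linear k]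
  [ω.Faithful] [PreservesFiniteLimits ω] [PreservesFiniteColimits ω]

/-- The comultiplication of `A_X`. -/
def comulMap (P : QuotientObject ω X) : P.A →ₗ[k] P.A ⊗[k] P.A :=
  ∑ i, TensorProduct.mk k P.A P.A (Module.finBasis k P.A i) ∘ₗ
    (P.a P.obj P.generated_obj).flip ((Module.finBasis k P.A).coord i)

/-- With `f : V ⟶ P_X` representing `x`, the matrix of `ω(f)` can be moved across the tensor sign,
which trades the basis of `A_X` for that of `ω(V)`. -/
theorem isComul_comulMap (P : QuotientObject ω X) : P.IsComul P.comulMap := by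
  intro V hV n c v x
  obtain ⟨f, -, hf⟩ := P.exists_hom_eq hV x
  let b := Module.finBasis k P.A
  have h₁ (i) : P.a P.obj P.generated_obj (fibMap ω f v) (b.coord i) =
      ∑ j, b.coord i (fibMap ω f (c j)) • P.a V hV v (c.coord j) := by
    have : b.coord i ∘ₗ fibMap ω f = ∑ j, b.coord i (fibMap ω f (c j)) • c.coord j :=
      c.ext fun l => by
        simp [LinearMap.sum_apply, Finsupp.single_apply]
    rw [← P.a_comp_fibMap hV P.generated_obj, this, map_sum]
    simp only [map_smul]
  calc P.comulMap (P.a V hV v x)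
      = ∑ i, b i ⊗ₜ[k] P.a P.obj P.generated_obj (fibMap ω f v) (b.coord i) := by
        rw [hf, comulMap, LinearMap.sum_apply]
        rfl
    _ = ∑ j, (∑ i, b.coord i (fibMap ω f (c j)) • b i) ⊗ₜ[k] P.a V hV v (c.coord j) := by
        simp only [h₁, TensorProduct.tmul_sum, TensorProduct.sum_tmul, TensorProduct.tmul_smul,
          TensorProduct.smul_tmul']
        exact Finset.sum_comm
    _ = ∑ j, P.a V hV (c j) x ⊗ₜ[k] P.a V hV v (c.coord j) := by
        refine Finset.sum_congr rfl fun j _ => ?_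
        rw [hf]
        congr 1
        exact b.sum_repr _

theorem IsComul.unique {P : QuotientObject ω X} {D D' : P.A →ₗ[k] P.A ⊗[k] P.A}
    (h : P.IsComul D) (h' : P.IsComul D') : D = D' :=
  P.hom_ext_a fun V hV v x => by
    rw [h V hV _ (Module.finBasis k _), h' V hV _ (Module.finBasis k _)]

theorem IsCounit.unique {P : QuotientObject ω X} {e e' : P.A →ₗ[k] k}
    (h : P.IsCounit e) (h' : P.IsCounit e') : e = e' :=
  P.hom_ext_a fun V hV v x => by rw [h V hV, h' V hV]

/-- The coalgebra structure on `A_X`. -/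
@[reducible]
def coalgebra (P : QuotientObject ω X) : Coalgebra k P.A where
  comul := P.comulMap
  counit := P.counitForm
  coassoc := P.hom_ext_a fun V hV v x => by
    have h (v) (x) := P.isComul_comulMap V hV _ (Module.finBasis k (ω.obj V)) v x
    simp only [LinearMap.comp_apply, h, map_sum, LinearMap.rTensor_tmul, LinearMap.lTensor_tmul,
      TensorProduct.sum_tmul, TensorProduct.tmul_sum, LinearEquiv.coe_coe,
      TensorProduct.assoc_tmul]
    exact Finset.sum_comm
  rTensor_counit_comp_comul := P.hom_ext_a fun V hV v x => by
    let c := Module.finBasis k (ω.obj V)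
    have hx : ∑ i, x (c i) • c.coord i = x := c.ext fun l => by
      simp
    rw [LinearMap.comp_apply, P.isComul_comulMap V hV _ c]
    simp only [map_sum, LinearMap.rTensor_tmul, P.isCounit_counitForm V hV]
    conv_rhs => rw [← hx]
    simp only [map_sum, map_smul, TensorProduct.mk_apply]
    refine Finset.sum_congr rfl fun i _ => ?_
    rw [TensorProduct.smul_tmul', smul_eq_mul, mul_one]
  lTensor_counit_comp_comul := P.hom_ext_a fun V hV v x => by
    let c := Module.finBasis k (ω.obj V)
    rw [LinearMap.comp_apply, P.isComul_comulMap V hV _ c]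
    simp only [map_sum, LinearMap.lTensor_tmul, P.isCounit_counitForm V hV]
    conv_rhs => rw [← c.sum_repr v]
    simp only [map_sum, map_smul, LinearMap.sum_apply, LinearMap.smul_apply, LinearMap.flip_apply,
      TensorProduct.mk_apply]
    refine Finset.sum_congr rfl fun i _ => ?_
    rw [← TensorProduct.tmul_smul, smul_eq_mul, mul_one]
    rfl

end QuotientObject

end Tannaka

/-! ### Tensor products and duals in the fibre -/

namespace Tannaka

section TensorVec

variable {k : Type u} [Field k] {C : Type u₁} [Category.{v₁} C] [MonoidalCategory C]
  (ω : C ⥤ FGModuleCat.{u} k) [ω.Monoidal]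

/-- `v ⊗ w` as a bilinear map. -/
def tensorVecₗ (V W : C) : ω.obj V →ₗ[k] ω.obj W →ₗ[k] ω.obj (V ⊗ W) :=
  TensorProduct.curry (Functor.LaxMonoidal.μ ω V W).hom.hom

theorem tensorVecₗ_apply {V W : C} (v : ω.obj V) (w : ω.obj W) :
    tensorVecₗ ω V W v w = tensorVec ω v w := rfl

theorem fibMap_tensorHom {V V' W W' : C} (f : V ⟶ V') (g : W ⟶ W') (v : ω.obj V) (w : ω.obj W) :
    fibMap ω (f ⊗ₘ g) (tensorVec ω v w) = tensorVec ω (fibMap ω f v) (fibMap ω g w) :=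
  (LinearMap.congr_fun (congrArg (fun h => h.hom.hom)
    (Functor.LaxMonoidal.μ_natural ω f g)) (v ⊗ₜ[k] w)).symm

theorem fibMap_whiskerLeft (V : C) {W W' : C} (g : W ⟶ W') (v : ω.obj V) (w : ω.obj W) :
    fibMap ω (V ◁ g) (tensorVec ω v w) = tensorVec ω v (fibMap ω g w) := by
  rw [← id_tensorHom, fibMap_tensorHom, fibMap_id, LinearMap.id_apply]

theorem fibMap_whiskerRight {V V' : C} (f : V ⟶ V') (W : C) (v : ω.obj V) (w : ω.obj W) :
    fibMap ω (f ▷ W) (tensorVec ω v w) = tensorVec ω (fibMap ω f v) w := by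
  rw [← tensorHom_id, fibMap_tensorHom, fibMap_id, LinearMap.id_apply]

theorem fibMap_associator {U V W : C} (x : ω.obj U) (v : ω.obj V) (w : ω.obj W) :
    fibMap ω (α_ U V W).hom (tensorVec ω (tensorVec ω x v) w) =
      tensorVec ω x (tensorVec ω v w) :=
  LinearMap.congr_fun (congrArg (fun h => h.hom.hom)
    (Functor.LaxMonoidal.associativity ω U V W)) ((x ⊗ₜ[k] v) ⊗ₜ[k] w)

theorem fibMap_associator_inv {U V W : C} (x : ω.obj U) (v : ω.obj V) (w : ω.obj W) :
    fibMap ω (α_ U V W).inv (tensorVec ω x (tensorVec ω v w)) =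
      tensorVec ω (tensorVec ω x v) w := by
  rw [← fibMap_associator, ← LinearMap.comp_apply, ← fibMap_comp, Iso.hom_inv_id, fibMap_id,
    LinearMap.id_apply]

theorem fibMap_leftUnitor {V : C} (v : ω.obj V) :
    fibMap ω (λ_ V).hom (tensorVec ω (unitVec ω) v) = v := by
  have := LinearMap.congr_fun (congrArg (fun h => h.hom.hom)
    (Functor.LaxMonoidal.left_unitality ω V)) ((1 : k) ⊗ₜ[k] v)
  exact this.symm.trans (one_smul k v)

theorem fibMap_rightUnitor {V : C} (v : ω.obj V) :
    fibMap ω (ρ_ V).hom (tensorVec ω v (unitVec ω)) = v := by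
  have := LinearMap.congr_fun (congrArg (fun h => h.hom.hom)
    (Functor.LaxMonoidal.right_unitality ω V)) (v ⊗ₜ[k] (1 : k))
  exact this.symm.trans (one_smul k v)

theorem exists_tensorVec_eq {V W : C} (z : ω.obj (V ⊗ W)) :
    ∃ t : (ω.obj V : Type u) ⊗[k] ω.obj W, TensorProduct.lift (tensorVecₗ ω V W) t = z := by
  refine ⟨(Functor.OplaxMonoidal.δ ω V W).hom.hom z, ?_⟩
  have : TensorProduct.lift (tensorVecₗ ω V W) = (Functor.LaxMonoidal.μ ω V W).hom.hom :=
    TensorProduct.ext' fun _ _ => TensorProduct.lift.tmul _ _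
  rw [this]
  exact LinearMap.congr_fun (congrArg (fun h => h.hom.hom) (Functor.Monoidal.δ_μ ω V W)) z

theorem tensorVec_ext {V W : C} {M : Type*} [AddCommMonoid M] [Module k M]
    {f g : ω.obj (V ⊗ W) →ₗ[k] M} (h : ∀ v w, f (tensorVec ω v w) = g (tensorVec ω v w)) :
    f = g := by
  ext z
  obtain ⟨t, rfl⟩ := exists_tensorVec_eq ω z
  induction t with
  | zero => simp
  | tmul v w => rw [TensorProduct.lift.tmul]; exact h v w
  | add a b ha hb => rw [map_add, map_add, map_add, ha, hb]

theorem exists_sum_tensorVec {V W : C} (z : ω.obj (V ⊗ W)) :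
    ∃ (n : ℕ) (v : Fin n → ω.obj V) (w : Fin n → ω.obj W), z = ∑ i, tensorVec ω (v i) (w i) := by
  obtain ⟨t, rfl⟩ := exists_tensorVec_eq ω z
  obtain ⟨n, v, w, rfl⟩ := TensorProduct.exists_sum_tmul_eq t
  exact ⟨n, v, w, by simp [map_sum]; rfl⟩

theorem tensorForm_tensorVec {V W : C} (x : Module.Dual k (ω.obj V)) (y : Module.Dual k (ω.obj W))
    (v : ω.obj V) (w : ω.obj W) : tensorForm ω x y (tensorVec ω v w) = x v * y w := by
  have := LinearMap.congr_fun (congrArg (fun h => h.hom.hom) (Functor.Monoidal.μ_δ ω V W))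
    (v ⊗ₜ[k] w)
  change TensorProduct.dualDistrib k _ _ (x ⊗ₜ[k] y)
    ((Functor.LaxMonoidal.μ ω V W ≫ Functor.OplaxMonoidal.δ ω V W).hom.hom (v ⊗ₜ[k] w)) = _
  refine (congrArg _ this).trans ?_
  exact TensorProduct.dualDistrib_apply _ _ _ _

theorem tensorForm_comp_tensorHom {V V' W W' : C} (f : V ⟶ V') (g : W ⟶ W')
    (x : Module.Dual k (ω.obj V')) (y : Module.Dual k (ω.obj W')) :
    tensorForm ω x y ∘ₗ fibMap ω (f ⊗ₘ g) = tensorForm ω (x ∘ₗ fibMap ω f) (y ∘ₗ fibMap ω g) :=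
  tensorVec_ext ω fun v w => by
    rw [LinearMap.comp_apply, fibMap_tensorHom, tensorForm_tensorVec, tensorForm_tensorVec]
    rfl

theorem unitForm_smul_unitVec (z : ω.obj (𝟙_ C)) : unitForm ω z • unitVec ω = z := by
  have := LinearMap.congr_fun (congrArg (fun h => h.hom.hom) (Functor.Monoidal.η_ε ω)) z
  refine Eq.trans ?_ this
  change _ = (Functor.LaxMonoidal.ε ω).hom.hom (unitForm ω z)
  rw [unitVec, ← map_smul]
  congr 1
  exact mul_one (unitForm ω z)

theorem fibMap_tensorHom_surjective {V V' W W' : C} {f : V ⟶ V'} {g : W ⟶ W'}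
    (hf : Function.Surjective (fibMap ω f)) (hg : Function.Surjective (fibMap ω g)) :
    Function.Surjective (fibMap ω (f ⊗ₘ g)) := by
  intro z
  obtain ⟨n, v, w, rfl⟩ := exists_sum_tensorVec ω z
  choose v' hv' using fun i => hf (v i)
  choose w' hw' using fun i => hg (w i)
  exact ⟨∑ i, tensorVec ω (v' i) (w' i), by simp [map_sum, fibMap_tensorHom, hv', hw']⟩

/-- Linear retractions of `ω(f)` and `ω(g)` exist over a field. They need not come from morphisms of
`C`, so their tensor product is formed through `μ` and `δ`. -/
theorem fibMap_tensorHom_injective {V V' W W' : C} {f : V ⟶ V'} {g : W ⟶ W'}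
    (hf : Function.Injective (fibMap ω f)) (hg : Function.Injective (fibMap ω g)) :
    Function.Injective (fibMap ω (f ⊗ₘ g)) := by
  obtain ⟨r, hr⟩ := (fibMap ω f).exists_leftInverse_of_injective (LinearMap.ker_eq_bot.2 hf)
  obtain ⟨s, hs⟩ := (fibMap ω g).exists_leftInverse_of_injective (LinearMap.ker_eq_bot.2 hg)
  let q : ω.obj (V' ⊗ W') →ₗ[k] ω.obj (V ⊗ W) :=
    (Functor.LaxMonoidal.μ ω V W).hom.hom ∘ₗ TensorProduct.map r s ∘ₗ
      (Functor.OplaxMonoidal.δ ω V' W').hom.hom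
  have hq (v : ω.obj V') (w : ω.obj W') :
      q (tensorVec ω v w) = tensorVec ω (r v) (s w) := by
    have := LinearMap.congr_fun (congrArg (fun h => h.hom.hom) (Functor.Monoidal.μ_δ ω V' W'))
      (v ⊗ₜ[k] w)
    exact (congrArg (fun t => (Functor.LaxMonoidal.μ ω V W).hom.hom (TensorProduct.map r s t))
      this).trans rfl
  have : q ∘ₗ fibMap ω (f ⊗ₘ g) = LinearMap.id := tensorVec_ext ω fun v w => by
    rw [LinearMap.comp_apply, fibMap_tensorHom, hq, ← LinearMap.comp_apply, hr,
      ← LinearMap.comp_apply, hs]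
    rfl
  exact Function.LeftInverse.injective (g := q) fun z => LinearMap.congr_fun this z

end TensorVec

section DualPairing

variable {k : Type u} [Field k] {C : Type u₁} [Category.{v₁} C] [MonoidalCategory C]
  [RigidCategory C] (ω : C ⥤ FGModuleCat.{u} k) [ω.Monoidal]

theorem dualPairing_apply (V : C) (x : ω.obj (Vᘁ)) (v : ω.obj V) :
    dualPairing ω V x v = unitForm ω (fibMap ω (ε_ V (Vᘁ)) (tensorVec ω x v)) := rfl

theorem fibMap_evaluation (V : C) (x : ω.obj (Vᘁ)) (v : ω.obj V) :
    fibMap ω (ε_ V (Vᘁ)) (tensorVec ω x v) = dualPairing ω V x v • unitVec ω :=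
  (unitForm_smul_unitVec ω _).symm

theorem dualPairing_fibMap_dual {V W : C} (f : V ⟶ W) (x : ω.obj (Wᘁ)) :
    dualPairing ω V (fibMap ω (fᘁ) x) = dualPairing ω W x ∘ₗ fibMap ω f := by
  ext v
  have := LinearMap.congr_fun (congrArg (fibMap ω) (rightAdjointMate_comp_evaluation f))
    (tensorVec ω x v)
  rw [fibMap_comp, fibMap_comp, LinearMap.comp_apply, LinearMap.comp_apply, fibMap_whiskerRight,
    fibMap_whiskerLeft] at this
  exact congrArg (unitForm ω) this

/-- The coevaluation applied to the unit vector is `∑ c_i ⊗ c'_i`, and the two expansions are the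
two triangle identities. Hence the pairing is perfect. -/
theorem exists_dual_family (V : C) : ∃ (n : ℕ) (c : Fin n → ω.obj V) (c' : Fin n → ω.obj (Vᘁ)),
    (∀ v, ∑ i, dualPairing ω V (c' i) v • c i = v) ∧
      ∀ x, ∑ i, dualPairing ω V x (c i) • c' i = x := by
  obtain ⟨n, c, c', h⟩ := exists_sum_tensorVec ω (fibMap ω (η_ V (Vᘁ)) (unitVec ω))
  have hl (v : ω.obj V) : tensorVec ω (∑ i, tensorVec ω (c i) (c' i)) v =
      ∑ i, tensorVec ω (tensorVec ω (c i) (c' i)) v := by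
    simp only [← tensorVecₗ_apply, map_sum, LinearMap.sum_apply]
  have hr (x : ω.obj (Vᘁ)) : tensorVec ω x (∑ i, tensorVec ω (c i) (c' i)) =
      ∑ i, tensorVec ω x (tensorVec ω (c i) (c' i)) := by
    simp only [← tensorVecₗ_apply, map_sum]
  have hls {U W : C} (a : k) (v : ω.obj U) (w : ω.obj W) :
      tensorVec ω (a • v) w = a • tensorVec ω v w := by
    simp only [← tensorVecₗ_apply, map_smul, LinearMap.smul_apply]
  have hrs {U W : C} (a : k) (v : ω.obj U) (w : ω.obj W) :
      tensorVec ω v (a • w) = a • tensorVec ω v w := by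
    simp only [← tensorVecₗ_apply, map_smul]
  refine ⟨n, c, c', fun v => ?_, fun x => ?_⟩
  · have e : (η_ V (Vᘁ) ▷ V ≫ (α_ _ _ _).hom ≫ V ◁ ε_ V (Vᘁ)) ≫ (ρ_ V).hom = (λ_ V).hom := by
      simp
    have := LinearMap.congr_fun (congrArg (fibMap ω) e) (tensorVec ω (unitVec ω) v)
    simpa only [fibMap_comp, LinearMap.comp_apply, fibMap_whiskerRight, h, hl, map_sum,
      fibMap_associator, fibMap_whiskerLeft, fibMap_evaluation, hrs, map_smul,
      fibMap_rightUnitor, fibMap_leftUnitor] using this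
  · have e : (Vᘁ ◁ η_ V (Vᘁ) ≫ (α_ _ _ _).inv ≫ ε_ V (Vᘁ) ▷ Vᘁ) ≫ (λ_ _).hom = (ρ_ _).hom := by
      simp
    have := LinearMap.congr_fun (congrArg (fibMap ω) e) (tensorVec ω x (unitVec ω))
    simpa only [fibMap_comp, LinearMap.comp_apply, fibMap_whiskerRight, h, hr, map_sum,
      fibMap_associator_inv, fibMap_whiskerLeft, fibMap_evaluation, hls, map_smul,
      fibMap_rightUnitor, fibMap_leftUnitor] using this

theorem dualPairing_injective (V : C) : Function.Injective (dualPairing ω V) := by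
  obtain ⟨n, c, c', -, h⟩ := exists_dual_family ω V
  intro x y hxy
  rw [← h x, ← h y, hxy]

theorem dualPairing_surjective (V : C) : Function.Surjective (dualPairing ω V) := by
  obtain ⟨n, c, c', h, -⟩ := exists_dual_family ω V
  refine fun y => ⟨∑ i, y (c i) • c' i, ?_⟩
  ext v
  conv_rhs => rw [← h v]
  simp [LinearMap.sum_apply, mul_comm]

theorem sum_tensorForm_flip_dualPairing (V : C) {n : ℕ}
    (b : Module.Basis (Fin n) k (ω.obj V)) :
    ∑ i, tensorForm ω ((dualPairing ω V).flip (b i)) (b.coord i) =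
      unitForm ω ∘ₗ fibMap ω (ε_ V (Vᘁ)) :=
  tensorVec_ext ω fun x v => by
    rw [LinearMap.sum_apply, LinearMap.comp_apply, ← dualPairing_apply]
    simp only [tensorForm_tensorVec, LinearMap.flip_apply]
    conv_rhs => rw [← b.sum_repr v, map_sum]
    simp [mul_comm]

variable {ω}

theorem fibMap_dual_injective {V W : C} {f : V ⟶ W} (hf : Function.Surjective (fibMap ω f)) :
    Function.Injective (fibMap ω (fᘁ)) := by
  intro x y hxy
  apply dualPairing_injective ω W
  have := congrArg (dualPairing ω V) hxy
  rw [dualPairing_fibMap_dual, dualPairing_fibMap_dual] at this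
  exact (LinearMap.cancel_right hf).1 this

theorem fibMap_dual_surjective {V W : C} {f : V ⟶ W} (hf : Function.Injective (fibMap ω f)) :
    Function.Surjective (fibMap ω (fᘁ)) := by
  intro x
  obtain ⟨y, hy⟩ := LinearMap.dualMap_surjective_of_injective hf (dualPairing ω V x)
  obtain ⟨z, rfl⟩ := dualPairing_surjective ω W y
  exact ⟨z, dualPairing_injective ω V ((dualPairing_fibMap_dual ω f z).trans hy)⟩

end DualPairing

end Tannaka

/-! ### Multiplication, coinverse and the coinverse axiom -/

namespace Tannaka

variable {k : Type u} [Field k] {C : Type u₁} [Category.{v₁} C] [Abelian C]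
  [MonoidalCategory C]

section Generated

variable {X Y Z : C}

theorem generated.tensor_power [MonoidalPreadditive C] (hZ : generated Z (Y ⊗ X)) (n m : ℕ) :
    generated Z ((⨁ fun _ : Fin n => Y) ⊗ ⨁ fun _ : Fin m => X) := by
  have h : generated Z (Y ⊗ ⨁ fun _ : Fin m => X) :=
    (generated.biproduct fun _ : Fin m => hZ).of_mono (leftDistributor Y fun _ : Fin m => X).hom
  exact (generated.biproduct fun _ : Fin n => h).of_mono
    (rightDistributor (fun _ : Fin n => Y) _).hom

/-- That `⊗` preserves the monomorphisms and epimorphisms of the two presentations is checked in the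
fibres. -/
theorem generated.tensor (ω : C ⥤ FGModuleCat.{u} k) [ω.Monoidal] [ω.Faithful]
    [PreservesFiniteLimits ω] [PreservesFiniteColimits ω] [MonoidalPreadditive C]
    (hZ : generated Z (Y ⊗ X)) {V W : C} (hV : generated Y V) (hW : generated X W) : generated Z (V ⊗ W) := by
  obtain ⟨n, U, i, p, hi, hp⟩ := hV
  obtain ⟨m, U', j, q, hj, hq⟩ := hW
  have : Mono (i ⊗ₘ j) := mono_of_fibMap_injective (ω := ω)
    (fibMap_tensorHom_injective ω (fibMap_injective_of_mono ω i) (fibMap_injective_of_mono ω j))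
  have : Epi (p ⊗ₘ q) := epi_of_fibMap_surjective (ω := ω)
    (fibMap_tensorHom_surjective ω (fibMap_surjective_of_epi ω p) (fibMap_surjective_of_epi ω q))
  exact ((hZ.tensor_power n m).of_mono (i ⊗ₘ j)).of_epi (p ⊗ₘ q)

/-- Dualizing `V ↞ U ↪ X^n` presents `V^*` as a subobject of a quotient of `(X^n)^*`, which embeds
in `(X^*)^n`. -/
theorem generated.dual (ω : C ⥤ FGModuleCat.{u} k) [ω.Monoidal] [ω.Faithful]
    [PreservesFiniteLimits ω] [PreservesFiniteColimits ω] [ω.Additive]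
    [RigidCategory C] (hY : generated Y (Xᘁ)) {V : C}
    (hV : generated X V) : generated Y (Vᘁ) := by
  obtain ⟨n, U, i, p, hi, hp⟩ := hV
  let ι (j : Fin n) : X ⟶ ⨁ fun _ : Fin n => X := biproduct.ι (fun _ => X) j
  let l : (⨁ fun _ : Fin n => X)ᘁ ⟶ ⨁ fun _ : Fin n => Xᘁ := biproduct.lift fun j => (ι j)ᘁ
  have : Mono l := mono_of_fibMap_injective (ω := ω) fun x y hxy => by
    apply dualPairing_injective ω
    refine fibMap_biproduct_ext ω fun j => ?_
    rw [← dualPairing_fibMap_dual, ← dualPairing_fibMap_dual]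
    have hl : l ≫ biproduct.π _ j = (ι j)ᘁ := biproduct.lift_π _ _
    change dualPairing ω X (fibMap ω ((ι j)ᘁ) x) = dualPairing ω X (fibMap ω ((ι j)ᘁ) y)
    rw [← hl, fibMap_comp, LinearMap.comp_apply, LinearMap.comp_apply, hxy]
  have : Epi (iᘁ) := epi_of_fibMap_surjective (ω := ω)
    (fibMap_dual_surjective (fibMap_injective_of_mono ω i))
  have : Mono (pᘁ) := mono_of_fibMap_injective (ω := ω)
    (fibMap_dual_injective (fibMap_surjective_of_epi ω p))
  exact (((generated.biproduct fun _ : Fin n => hY).of_mono l).of_epi (iᘁ)).of_mono (pᘁ)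

end Generated

namespace QuotientObject

variable [Linear k C] {ω : C ⥤ FGModuleCat.{u} k} [ω.Monoidal] [ω.Additive] [ω.Linear k]
  [ω.Faithful] [PreservesFiniteLimits ω] [PreservesFiniteColimits ω] {X Y Z : C}

section Coinverse

variable [RigidCategory C]

theorem IsCoinverse.unique {P : QuotientObject ω X} {Q : QuotientObject ω Y}
    {S S' : P.A →ₗ[k] Q.A} (h : P.IsCoinverse Q S) (h' : P.IsCoinverse Q S') : S = S' :=
  P.hom_ext_a fun V hV v x => by
    obtain ⟨y, rfl⟩ := dualPairing_surjective ω V x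
    exact ((h V hV).2 v y).trans ((h' V hV).2 v y).symm

/-- Since `p = a_P(p ⊗ ε)`, the only choice is `S(p) = a_{P^*}(y ⊗ p)`, where the vector `y` of
`ω(P^*)` corresponds to `ε`. The general formula is transport along the dual of `f`. -/
theorem exists_isCoinverse (P : QuotientObject ω X) (Q : QuotientObject ω Y)
    (hY : generated Y (Xᘁ)) : ∃ S : P.A →ₗ[k] Q.A, P.IsCoinverse Q S := by
  obtain ⟨y, hy⟩ := dualPairing_surjective ω P.obj P.counitForm
  refine ⟨Q.a _ (generated.dual ω hY P.generated_obj) y ∘ₗ (dualPairing ω P.obj).flip,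
    fun V hV => ⟨generated.dual ω hY hV, fun v x => ?_⟩⟩
  obtain ⟨f, hf, hfa⟩ := P.exists_hom_eq hV (dualPairing ω V x)
  have hx : fibMap ω (fᘁ) y = x := dualPairing_injective ω V <| by
    rw [dualPairing_fibMap_dual, hy, hf]
  have hv : (dualPairing ω P.obj).flip (fibMap ω f v) =
      (dualPairing ω V).flip v ∘ₗ fibMap ω (fᘁ) := by
    ext z
    exact (LinearMap.congr_fun (dualPairing_fibMap_dual ω f z) v).symm
  rw [hfa, LinearMap.comp_apply, hv, Q.a_comp_fibMap _ (generated.dual ω hY hV), hx]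

end Coinverse

section Mul

variable {Q : QuotientObject ω Y} {P : QuotientObject ω X} {R : QuotientObject ω Z}

theorem IsMul.unique {m m' : Q.A →ₗ[k] P.A →ₗ[k] R.A} (h : IsMul Q P R m) (h' : IsMul Q P R m') :
    m = m' :=
  Q.hom_ext_a fun V hV v x => P.hom_ext_a fun W hW w y =>
    ((h V W hV hW).2 v x w y).trans ((h' V W hV hW).2 v x w y).symm

variable (Q P R) in
-- Likewise the product of `p` and `q` has to be the symbol of `p ⊗ q` and `ε ⊗ ε` on the tensor
-- product of the two universal objects.
theorem exists_isMul [MonoidalPreadditive C] (hZ : generated Z (Y ⊗ X)) :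
    ∃ m : Q.A →ₗ[k] P.A →ₗ[k] R.A, IsMul Q P R m := by
  refine ⟨(tensorVecₗ ω Q.obj P.obj).compr₂ ((R.a _ (generated.tensor ω hZ Q.generated_obj
    P.generated_obj)).flip (tensorForm ω Q.counitForm P.counitForm)),
    fun V W hV hW => ⟨generated.tensor ω hZ hV hW, fun v x w y => ?_⟩⟩
  obtain ⟨f, rfl, hf⟩ := Q.exists_hom_eq hV x
  obtain ⟨g, rfl, hg⟩ := P.exists_hom_eq hW y
  rw [hf, hg, ← tensorForm_comp_tensorHom,
    R.a_comp_fibMap _ (generated.tensor ω hZ Q.generated_obj P.generated_obj), fibMap_tensorHom]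
  rfl

end Mul

/-- All terms of the sum lie over `V^* ⊗ V` with the same vector `y ⊗ v`, and their forms `∑ v_i ⊗
u_i` add up to the pullback of the unit form along evaluation. Transport to the unit object leaves
`ω(ev)(y ⊗ v)`, a scalar multiple of `e`. -/
theorem coinverse_axiom [RigidCategory C] {P : QuotientObject ω X} {Q : QuotientObject ω Y}
    {R : QuotientObject ω Z} {S : P.A →ₗ[k] Q.A} (hS : P.IsCoinverse Q S)
    {m : Q.A →ₗ[k] P.A →ₗ[k] R.A} (hm : IsMul Q P R m) (h1 : generated Z (𝟙_ C)) :
    TensorProduct.lift m ∘ₗ TensorProduct.map S LinearMap.id ∘ₗ P.comulMap =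
      LinearMap.toSpanSingleton k R.A (R.one h1) ∘ₗ P.counitForm :=
  P.hom_ext_a fun V hV v x => by
    obtain ⟨y, rfl⟩ := dualPairing_surjective ω V x
    obtain ⟨hV', hSV⟩ := hS V hV
    obtain ⟨hVV, hmV⟩ := hm (Vᘁ) V hV' hV
    let b := Module.finBasis k (ω.obj V)
    rw [LinearMap.comp_apply, LinearMap.comp_apply, LinearMap.comp_apply,
      P.isComul_comulMap V hV _ b, P.isCounit_counitForm V hV]
    simp only [map_sum, TensorProduct.map_tmul, TensorProduct.lift.tmul, hSV, LinearMap.id_apply,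
      hmV]
    rw [← map_sum, sum_tensorForm_flip_dualPairing, R.a_comp_fibMap hVV h1, fibMap_evaluation,
      map_smul]
    rfl

end QuotientObject

end Tannaka

end

theorem proposition3p9 {k : Type u} [Field k]
    {C : Type u₁} [Category.{v₁} C] [Abelian C] [Linear k C]
    [MonoidalCategory C] [MonoidalPreadditive C] [MonoidalLinear k C]
    [SymmetricCategory C] [RigidCategory C]
    (hEnd : Function.Bijective fun c : k => c • 𝟙 (𝟙_ C))
    (ω : C ⥤ FGModuleCat.{u} k) [ω.Additive] [ω.Linear k] [ω.Faithful]
    [PreservesFiniteLimits ω] [PreservesFiniteColimits ω] [ω.Braided] (X : C) :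
    -- the object `P_X` of `C` exists
    Nonempty (Tannaka.QuotientObject ω X) ∧
    ∀ P : Tannaka.QuotientObject ω X,
      -- `A_X = ω(P_X)` is the quotient `ω(F_X) / ω(R_X)`, and is finite dimensional
      Module.Finite k P.A ∧
      Function.Surjective P.fromSum ∧
      LinearMap.ker P.fromSum = Tannaka.relations ω X ∧
      -- `Δ` and `ε` are well defined
      (∃! Δ : P.A →ₗ[k] P.A ⊗[k] P.A, P.IsComul Δ) ∧
      (∃! ε : P.A →ₗ[k] k, P.IsCounit ε) ∧
      -- they make `A_X` a coassociative counital coalgebra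
      ∃ coalg : Coalgebra k P.A, P.IsComul coalg.comul ∧ P.IsCounit coalg.counit ∧
        -- `S` is well defined, with values in `A_Y` for each `Y` with `X^*` in `{{Y}}`
        ∀ (Y : C) (Q : Tannaka.QuotientObject ω Y), Tannaka.generated Y (Xᘁ) →
          (∃! S : P.A →ₗ[k] Q.A, P.IsCoinverse Q S) ∧
          ∀ S : P.A →ₗ[k] Q.A, P.IsCoinverse Q S →
            -- the coinverse axiom `m ∘ (S ⊗ id) ∘ Δ = ε · 1`
            ∀ (Z : C) (R : Tannaka.QuotientObject ω Z), Tannaka.generated Z (Y ⊗ X) →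
              ∀ h1 : Tannaka.generated Z (𝟙_ C),
                (∃! m : Q.A →ₗ[k] P.A →ₗ[k] R.A, Tannaka.QuotientObject.IsMul Q P R m) ∧
                ∀ m : Q.A →ₗ[k] P.A →ₗ[k] R.A, Tannaka.QuotientObject.IsMul Q P R m →
                  TensorProduct.lift m ∘ₗ TensorProduct.map S LinearMap.id ∘ₗ coalg.comul =
                    LinearMap.toSpanSingleton k R.A (R.one h1) ∘ₗ coalg.counit := by
  refine ⟨Tannaka.QuotientObject.nonempty ω X, fun P => ⟨inferInstanceAs
    (Module.Finite k (ω.obj P.obj)), P.fromSum_surjective, P.ker_fromSum,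
    ⟨P.comulMap, P.isComul_comulMap, fun _ h => h.unique P.isComul_comulMap⟩,
    ⟨P.counitForm, P.isCounit_counitForm, fun _ h => h.unique P.isCounit_counitForm⟩,
    P.coalgebra, P.isComul_comulMap, P.isCounit_counitForm, fun Y Q hY => ⟨?_, ?_⟩⟩⟩
  · obtain ⟨S, hS⟩ := P.exists_isCoinverse Q hY
    exact ⟨S, hS, fun _ h => h.unique hS⟩
  · intro S hS Z R hZ h1
    obtain ⟨m, hm⟩ := Tannaka.QuotientObject.exists_isMul Q P R hZ
    exact ⟨⟨m, hm, fun _ h => h.unique hm⟩, fun m' hm' =>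
      Tannaka.QuotientObject.coinverse_axiom hS hm' h1⟩
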